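/- **Theorem 3.** Consider a decision tree of depth $d$ whose complete branches (leaves) form a non-empty set $I\subseteq\prod_{k=1}^d\{1,\dots,N_k\}$, and let $\mathbf T:I\to\mathbb R$ be the true leaf values. Let $\mathcal Q$ be any tensor-train model, i.e. $\mathcal Q(i_1,\dots,i_d)=\mathcal Q^1_{:,i_1,:}\cdots\mathcal Q^d_{:,i_d,:}$ with cores of ranks $r_0=1,r_1,\dots,r_d=1$. Each evaluation of a leaf $x\in I$ returns a reward; the successive rewards of $x$ are integrable, identically distributed and pairwise independent with mean $\mathbf T(x)$ (exact evaluation, where every reward equals $\mathbf T(x)$, is a special case). Let $c>0$ and $\tau\ge 1$. Tensor Train Tree Search (TTTS) keeps for every node $p$ a visit count $v_p$, initially $0$, and a cumulative reward $w_p$, initially the sum of $\mathcal Q$ over all completions of $p$ to a full multi-index (so $w_x=\mathcal Q(x)$ at a leaf). In each iteration, starting from the root, it selects in each layer, among the children of the expanded nodes selected in the layer above (a non-root node is expanded once it has been visited in an earlier iteration), the $\tau$ nodes $p$ with the largest upper confidence bounds $$\mathrm{UCB}(p)=\frac{w_p}{v_p}+c\sqrt{\frac{\log v_{\mathrm{parent}(p)}}{v_p}}\qquad(\mathrm{UCB}(p)=+\infty\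 \text{if } v_p=0),$$ or all of them if there are fewer, ties being broken arbitrarily. From every selected node that is a leaf or not yet expanded, one completion in $I$ is simulated (by any rollout policy) and its leaf is evaluated. Finally every selected node gets one more visit, and the rewards of the leaves below it that were evaluated in this iteration are added to its cumulative reward. Let $\widehat Q_l(x)$ be the value $w_x/v_x$ of the leaf $x$ after $l$ iterations (and $\mathcal Q(x)$ as long as $v_x=0$). Then, for every tensor-train model $\mathcal Q$, TTTS retains the asymptotic global convergence of Monte Carlo Tree Search. Almost surely, 1. every node of the tree is visited infinitely often; 2. $\displaystyle\lim_{l\to\infty}\max_{x\in I}\bigl|\widehat Q_l(x)-\mathbf T(x)\bigr|=0$; 3. for all sufficiently large $l$, $\arg\max_{x\in I}\widehat Q_l(x)\subseteq\arg\max_{x\in I}\mathbf T(x)$. Moreover, the initialization does not change the UCB exploration mechanism: for every history of selections, simulations and rewards, the initialization with $\mathcal Q$ and the plain initialization with $0$ give the same visit counts, hence the same exploration terms $c\sqrt{\log v_{\mathrm{parent}(p)}/v_p}$, and the same infinite priority of unvisited nodes; at every visited non-root node $p$ the upper confidence bounds differ exactly by $w_p^0/v_p$ in the exploitation term, where $w^0_p$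 is the sum of $\mathcal Q$ over the completions of $p$. -/

import Mathlib

open MeasureTheory ProbabilityTheory Filter Topology

namespace TTTS

/-- Complete branches of a decision tree of depth `d` whose layer `k` offers `N k` choices; these are
the multi-indices of a tensor of size `N 0 × ⋯ × N (d-1)`. -/
abbrev Leaf {d : ℕ} (N : Fin d → ℕ) : Type := (k : Fin d) → Fin (N k)

/-- Partial branches of length `j` (for `j ≤ d`): the choices made in the layers before `j`. -/
abbrev Prefix {d : ℕ} (N : Fin d → ℕ) (j : ℕ) : Type :=
  (k : Fin d) → (k : ℕ) < j → Fin (N k)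

/-- A tensor-train model: ranks `r₀ = 1, r₁, …, r_d = 1`, and for each layer a core, whose slices are
`r_k × r_{k+1}` matrices. -/
structure TTModel {d : ℕ} (N : Fin d → ℕ) where
  rank : ℕ → ℕ
  rank_zero : rank 0 = 1
  rank_last : rank d = 1
  core : (k : Fin d) → Fin (N k) → Matrix (Fin (rank k)) (Fin (rank (k + 1))) ℝ

section
variable {d : ℕ} {N : Fin d → ℕ}

/-- The product of the first `j` core slices selected by `x`. -/
def TTModel.partialProd (M : TTModel N) (x : Leaf N) :
    (j : ℕ) → j ≤ d → Matrix (Fin (M.rank 0)) (Fin (M.rank j)) ℝ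
  | 0, _ => 1
  | j + 1, h => M.partialProd x j (Nat.le_of_succ_le h) * M.core ⟨j, h⟩ (x ⟨j, h⟩)

/-- The tensor entry represented by a tensor-train model: the (one by one) product of the selected
slices of all the cores. -/
def TTModel.eval (M : TTModel N) (x : Leaf N) : ℝ :=
  M.partialProd x d le_rfl ⟨0, by rw [M.rank_zero]; exact one_pos⟩
    ⟨0, by rw [M.rank_last]; exact one_pos⟩

/-- The node at depth `j` on the branch `x`. -/
def take (j : ℕ) (x : Leaf N) : Prefix N j := fun k _ => x k

/-- The parent of a node. -/
def parent {j : ℕ} (p : Prefix N (j + 1)) : Prefix N j := fun k hk => p k (Nat.lt_succ_of_lt hk)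

open Classical in
/-- The nodes at depth `j` of the tree whose set of complete branches is `I`. -/
noncomputable def layer (I : Finset (Leaf N)) (j : ℕ) : Finset (Prefix N j) := I.image (take j)

open Classical in
/-- The sum of the tensor `Q` over all completions of the partial branch `p`. -/
noncomputable def completionSum (Q : Leaf N → ℝ) (j : ℕ) (p : Prefix N j) : ℝ :=
  ∑ x : Leaf N, if take j x = p then Q x else 0

/-- The statistics kept by the search: the visit count and the cumulative reward of every node, and
the number of times that each complete branch has been evaluated. -/
structure State (N : Fin d → ℕ) where
  visits : (j : ℕ) → Prefix N j → ℕ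
  reward : (j : ℕ) → Prefix N j → ℝ
  evals : Leaf N → ℕ

/-- The state before the first iteration: no visits, and node values obtained by summing the initial
value tensor `Q` over completions (so that the leaf `x` has the value `Q x`). -/
noncomputable def initial (Q : Leaf N → ℝ) : State N where
  visits := fun _ _ => 0
  reward := completionSum Q
  evals := fun _ => 0

/-- The upper confidence bound of a non-root node; an unvisited node has infinite priority. -/
noncomputable def ucb (c : ℝ) (s : State N) (j : ℕ) (p : Prefix N (j + 1)) : EReal :=
  if s.visits (j + 1) p = 0 then ⊤
  else ((s.reward (j + 1) p / s.visits (j + 1) p +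
    c * √(Real.log (s.visits j (parent p)) / s.visits (j + 1) p) : ℝ) : EReal)

/-- The root is expanded from the start, and any other node at its first visit. -/
def Expanded (s : State N) (j : ℕ) (p : Prefix N j) : Prop := j = 0 ∨ 0 < s.visits j p

/-- Selection stops at the bottom of the tree and at nodes that are not expanded yet. -/
def Terminal (s : State N) (j : ℕ) (p : Prefix N j) : Prop := j = d ∨ ¬ Expanded s j p

/-- The choices made in one iteration: the nodes selected in each layer, and the complete branch that
is simulated (rolled out) from each node where selection stops. -/
structure Iteration (N : Fin d → ℕ) where
  beam : (j : ℕ) → Finset (Prefix N j)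
  sim : (j : ℕ) → Prefix N j → Leaf N

open Classical in
/-- The nodes at depth `j + 1` that can be selected: the children of the expanded nodes that are
selected at depth `j`. -/
noncomputable def candidates (I : Finset (Leaf N)) (s : State N) (it : Iteration N) (j : ℕ) :
    Finset (Prefix N (j + 1)) :=
  (layer I (j + 1)).filter fun p => parent p ∈ it.beam j ∧ Expanded s j (parent p)

/-- `it` is an iteration of the search from the state `s`: starting at the root, in each layer `τ`
candidates with the largest upper confidence bounds are selected (all of them, if there are fewer),
ties being broken in any way; from each node where selection stops, some completion is simulated, chosen
by any rollout policy. For `τ = 1` a single path is selected, as in plain tree search. -/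
structure IsSearchIteration (I : Finset (Leaf N)) (c : ℝ) (τ : ℕ) (s : State N)
    (it : Iteration N) : Prop where
  root : it.beam 0 = Finset.univ
  subset : ∀ j < d, it.beam (j + 1) ⊆ candidates I s it j
  card : ∀ j < d, (it.beam (j + 1)).card = min τ (candidates I s it j).card
  best : ∀ j < d, ∀ a ∈ candidates I s it j, a ∉ it.beam (j + 1) →
    ∀ b ∈ it.beam (j + 1), ucb c s j a ≤ ucb c s j b
  sim_mem : ∀ j ≤ d, ∀ p ∈ it.beam j, Terminal s j p →
    it.sim j p ∈ I ∧ take j (it.sim j p) = p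

open Classical in
/-- The complete branches evaluated in an iteration. -/
noncomputable def evaluated (s : State N) (it : Iteration N) : Finset (Leaf N) :=
  Finset.univ.filter fun x => ∃ j ≤ d, ∃ p ∈ it.beam j, Terminal s j p ∧ it.sim j p = x

open Classical in
/-- Backpropagation: every selected node is credited with one visit and with the rewards of the
evaluated branches through it. The reward of an evaluation of `x` is `ρ x k`, where `k` is the number of
earlier evaluations of `x`. -/
noncomputable def step (ρ : Leaf N → ℕ → ℝ) (s : State N) (it : Iteration N) : State N where
  visits := fun j p => s.visits j p + if p ∈ it.beam j then 1 else 0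
  reward := fun j p => s.reward j p +
    if p ∈ it.beam j then
      ∑ x ∈ (evaluated s it).filter (fun x => take j x = p), ρ x (s.evals x)
    else 0
  evals := fun x => s.evals x + if x ∈ evaluated s it then 1 else 0

/-- The state after `l` iterations with initial value tensor `Q`. -/
noncomputable def run (Q : Leaf N → ℝ) (ρ : Leaf N → ℕ → ℝ) (it : ℕ → Iteration N) : ℕ → State N
  | 0 => initial Q
  | l + 1 => step ρ (run Q ρ it l) (it l)

/-- The value estimate of the leaf `x`: cumulative reward over visit count, and the initial value as
long as there is no visit. -/
noncomputable def estimate (s : State N) (x : Leaf N) : ℝ :=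
  if s.visits d (take d x) = 0 then s.reward d (take d x)
  else s.reward d (take d x) / s.visits d (take d x)

end

end TTTS

/-! Almost surely the strong law gives convergent, hence bounded, reward averages at every leaf of
`I`, and everything else is deterministic. Once every node that is ever selected has been expanded,
rollouts start only at leaves, so visits and evaluations of a leaf differ by a constant. The initial
tensor also contributes only a constant to each cumulative reward. Hence exploitation terms at
visited nodes stay bounded, and a node with few visits relative to the logarithm of its parent's is
either selected or beaten only by a node that is almost as starved (`favorsStarved`).

With a beam, the winner may have another parent, so a starved node need not be selected itself.
`FavorsStarved.exists_earlier` handles this: a starved selection under a much visited parent forces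
an earlier starved selection under a parent that already had more visits. Going back repeatedly
would produce more parents than there are (`FavorsStarved.lt_card`). So starved selections hit only
nodes with few visits, which happens finitely often, and a child cannot stay starved under a parent
selected infinitely often (`FavorsStarved.tendsto_selCount`). Induction on depth gives infinitely
many visits everywhere, and the strong law then identifies the limits. -/

namespace TTTS

/-! ### Starvation and infinitely many selections -/

section Counting

/-- Among the times in a finite set of occurrences of `A`, the last one is preceded by all the others. -/
theorem exists_card_le_count_succ {A : ℕ → Prop} [DecidablePred A] (F : Finset ℕ) (hF : F.Nonempty)
    (hA : ∀ s ∈ F, A s) : ∃ s ∈ F, F.card ≤ Nat.count A s + 1 := by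
  refine ⟨F.max' hF, F.max'_mem hF, ?_⟩
  rw [Nat.count_eq_card_filter_range, ← Finset.card_erase_add_one (F.max'_mem hF)]
  gcongr
  intro s hs
  obtain ⟨hne, hs⟩ := Finset.mem_erase.1 hs
  exact Finset.mem_filter.2 ⟨Finset.mem_range.2 (lt_of_le_of_ne (F.le_max' s hs) hne), hA s hs⟩

/-- All occurrences of `A` before time `t`, except for the first `r`, come after at least `r` of them. -/
theorem count_le_card_filter_add (A : ℕ → Prop) [DecidablePred A] (r t : ℕ) :
    Nat.count A t ≤ ((Finset.range t).filter fun s => A s ∧ r ≤ Nat.count A s).card + r := by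
  rw [Nat.count_eq_card_filter_range,
    ← Finset.card_filter_add_card_filter_not (s := (Finset.range t).filter A)
      (fun s => r ≤ Nat.count A s), Finset.filter_filter]
  gcongr
  calc _ ≤ (Finset.range r).card := by
        refine Finset.card_le_card_of_injOn (fun s => Nat.count A s) ?_ ?_
        · intro s hs
          simp only [Finset.coe_filter, Finset.mem_filter, Finset.mem_range, not_le,
            Set.mem_ofPred_eq] at hs
          simpa using hs.2
        · intro s hs s' hs' h
          simp only [Finset.coe_filter, Finset.mem_filter, Finset.mem_range, not_le,
            Set.mem_ofPred_eq] at hs hs'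
          exact Nat.count_injective hs.1.2 hs'.1.2 h
    _ = r := Finset.card_range r

/-- Room between the square root and the logarithm. -/
theorem exists_pigeonhole_parameters (n m : ℕ) (hm : (2 * n + 3) ^ 2 ≤ m) :
    ∃ k r : ℕ, m ≤ r ^ 2 ∧ n * k + r < m ∧ Real.log m < k := by
  have hs : 2 * n + 3 ≤ Nat.sqrt m := by rw [Nat.le_sqrt']; exact hm
  have h1 : Nat.sqrt m ^ 2 ≤ m := Nat.sqrt_le' m
  have h2 : m < (Nat.sqrt m + 1) ^ 2 := Nat.lt_succ_sqrt' m
  have hm0 : 0 < m := lt_of_lt_of_le (by positivity) hm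
  -- With `s = Nat.sqrt m`, `n * k + r = (2n + 1)(s + 1) ≤ (s - 2)(s + 1) < s ^ 2 ≤ m`.
  refine ⟨2 * (Nat.sqrt m + 1), Nat.sqrt m + 1, h2.le, ?_, ?_⟩
  · nlinarith
  · have hr : (0 : ℝ) < (Nat.sqrt m + 1 : ℕ) := by positivity
    calc Real.log m ≤ Real.log (((Nat.sqrt m + 1 : ℕ) : ℝ) ^ 2) := by
          apply Real.log_le_log (by exact_mod_cast hm0)
          exact_mod_cast h2.le
      _ = 2 * Real.log (Nat.sqrt m + 1 : ℕ) := by rw [Real.log_pow]; norm_num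
      _ < ((2 * (Nat.sqrt m + 1) : ℕ) : ℝ) := by
          have := Real.log_le_sub_one_of_pos hr
          push_cast at this ⊢
          linarith

variable {α β : Type*}

open scoped Classical in
/-- The number of times before `t` at which `a` belongs to the selection. -/
noncomputable def selCount (sel : ℕ → Finset α) (t : ℕ) (a : α) : ℕ :=
  Nat.count (fun s => a ∈ sel s) t

open scoped Classical in
theorem selCount_mono (sel : ℕ → Finset α) (a : α) : Monotone fun t => selCount sel t a :=
  fun _ _ h => Nat.count_monotone _ h

open Classical in
theorem selCount_succ (sel : ℕ → Finset α) (t : ℕ) (a : α) :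
    selCount sel (t + 1) a = selCount sel t a + if a ∈ sel t then 1 else 0 := by
  simp [selCount, Nat.count_succ]

/-- At time `t` the number of visits of `a` is at most a fraction `1 / L` of the logarithm of the number
of visits of its parent. -/
def Starved (par : α → β) (sel : ℕ → Finset α) (beam : ℕ → Finset β) (L : ℝ) (t : ℕ) (a : α) : Prop :=
  L * selCount sel t a ≤ Real.log (selCount beam t (par a))

/-- Children are selected greedily, up to a constant factor, by starvation: when the parent of a node
starved at a level `L ≥ L₀` is selected, some node starved at level `L / 4` is selected. -/
structure FavorsStarved (par : α → β) (node : Set α) (sel : ℕ → Finset α) (beam : ℕ → Finset β)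
    (L₀ : ℝ) : Prop where
  mem_node : ∀ t, ∀ a ∈ sel t, a ∈ node
  par_mem : ∀ t, ∀ a ∈ sel t, par a ∈ beam t
  favors : ∀ L, L₀ ≤ L → ∀ t, ∀ a ∈ node, par a ∈ beam t → 0 < selCount beam t (par a) →
    Starved par sel beam L t a → ∃ b ∈ sel t, Starved par sel beam (L / 4) t b

variable {par : α → β} {node : Set α} {sel : ℕ → Finset α} {beam : ℕ → Finset β} {L₀ : ℝ}

theorem FavorsStarved.selCount_le (h : FavorsStarved par node sel beam L₀) (t : ℕ) (a : α) :
    selCount sel t a ≤ selCount beam t (par a) := by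
  induction t with
  | zero => simp [selCount]
  | succ t ih =>
    rw [selCount_succ, selCount_succ]
    split_ifs with h1 h2
    · lia
    · exact absurd (h.par_mem t a h1) h2
    · lia
    · lia

/-- If a starved node is selected while its parent has many visits, then earlier a starved node has been
selected whose parent had even more visits. -/
theorem FavorsStarved.exists_earlier [Fintype α] (h : FavorsStarved par node sel beam L₀) {L : ℝ}
    (hL : 2 * L₀ ≤ L) (hL8 : 8 ≤ L) {t : ℕ} {b : α} (hb : b ∈ sel t)
    (hst : Starved par sel beam L t b)
    (hm : (2 * Fintype.card α + 3) ^ 2 ≤ selCount beam t (par b)) :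
    ∃ s ≤ t, ∃ b' ∈ sel s, Starved par sel beam (L / 8) s b' ∧
      selCount beam t (par b) < selCount beam s (par b') := by
  classical
  set m := selCount beam t (par b) with hmdef
  obtain ⟨k, r, hr, hkr, hk⟩ := exists_pigeonhole_parameters _ m hm
  have hm0 : 0 < m := lt_of_lt_of_le (by positivity) hm
  have hr0 : 0 < r := by
    rcases Nat.eq_zero_or_pos r with rfl | h0
    · simp at hr; lia
    · exact h0
  set F := (Finset.range t).filter fun s =>
    par b ∈ beam s ∧ r ≤ Nat.count (fun s => par b ∈ beam s) s with hF
  have hcard : m ≤ F.card + r := count_le_card_filter_add (fun s => par b ∈ beam s) r t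
  have key : ∀ s ∈ F, ∃ b' ∈ sel s, Starved par sel beam (L / 8) s b' := by
    intro s hs
    obtain ⟨hst', hpb, hrs⟩ : s < t ∧ par b ∈ beam s ∧ r ≤ selCount beam s (par b) := by
      simpa [hF, selCount] using hs
    -- Since `m ≤ r ^ 2`, the logarithm of the parent's count at time `s` is at least half of `log
    -- m`, so going back costs only a factor 2 in the level.
    have := h.favors (L / 2) (by linarith) s b (h.mem_node t b hb) hpb (hr0.trans_le hrs) ?_
    · convert this using 4
      ring
    · have h1 : (selCount sel s b : ℝ) ≤ selCount sel t b := by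
        exact_mod_cast selCount_mono sel b hst'.le
      have h2 : Real.log m ≤ 2 * Real.log (selCount beam s (par b)) := by
        rw [show (2 : ℝ) = (2 : ℕ) by norm_num, ← Real.log_pow]
        apply Real.log_le_log (by exact_mod_cast hm0)
        exact_mod_cast hr.trans (Nat.pow_le_pow_left hrs 2)
      unfold Starved at hst ⊢
      rw [← hmdef] at hst
      have h3 : L * selCount sel s b ≤ L * selCount sel t b := by gcongr
      linarith
  have : Nonempty α := ⟨b⟩
  choose! g hg hgst using key
  obtain ⟨b', -, hb'⟩ := Finset.exists_lt_card_fiber_of_mul_lt_card_of_maps_to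
    (s := F) (t := Finset.univ) (f := g) (n := k) (fun _ _ => Finset.mem_univ _)
    (by rw [Finset.card_univ]; lia)
  -- At the last time in a fibre of size more than `k`, `b'` has at least `k > log m` visits; being
  -- starved at level at least 1, it has a parent with more than `m`.
  obtain ⟨s, hs, hsk⟩ := exists_card_le_count_succ (A := fun s => b' ∈ sel s) (F.filter fun s => g s = b')
    (Finset.card_pos.1 (by lia)) (by
      intro s hs
      obtain ⟨hsF, rfl⟩ := Finset.mem_filter.1 hs
      exact hg s hsF)
  obtain ⟨hsF, rfl⟩ := Finset.mem_filter.1 hs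
  refine ⟨s, ?_, g s, hg s hsF, hgst s hsF, ?_⟩
  · exact (Finset.mem_range.1 (Finset.mem_filter.1 hsF).1).le
  · have h1 : (k : ℝ) ≤ selCount sel s (g s) := by
      have : k ≤ selCount sel s (g s) := by
        unfold selCount
        lia
      exact_mod_cast this
    have h2 : Real.log m < Real.log (selCount beam s (par (g s))) := by
      have h3 := hgst s hsF
      unfold Starved at h3
      have h4 : 1 * (selCount sel s (g s) : ℝ) ≤ L / 8 * selCount sel s (g s) := by
        gcongr
        linarith
      linarith
    by_contra! hcon
    have : (selCount beam s (par (g s)) : ℝ) ≤ m := by exact_mod_cast hcon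
    rcases Nat.eq_zero_or_pos (selCount beam s (par (g s))) with h0 | h0
    · rw [h0] at h2
      simp only [Nat.cast_zero, Real.log_zero] at h2
      exact absurd h2 (not_lt.2 (Real.log_natCast_nonneg m))
    · exact absurd h2 (not_lt.2 (Real.log_le_log (by exact_mod_cast h0) this))

/-- Each step back in time by `exists_earlier` raises the threshold and lowers the counts, so the
set of parents above the threshold shrinks, strictly because `par b` drops out. Each step costs a
factor 8 in the level. -/
theorem FavorsStarved.lt_card [Fintype α] [Fintype β] (h : FavorsStarved par node sel beam L₀)
    {L : ℝ} (hL₀ : 2 * L₀ ≤ L) (hL8 : 8 ≤ L) (k : ℕ) {t : ℕ} {b : α} (hb : b ∈ sel t)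
    (hst : Starved par sel beam (8 ^ k * L) t b)
    (hm : (2 * Fintype.card α + 3) ^ 2 ≤ selCount beam t (par b)) :
    k < (Finset.univ.filter fun p => selCount beam t (par b) ≤ selCount beam t p).card := by
  induction k generalizing t b with
  | zero =>
    exact Finset.card_pos.2 ⟨par b, by simp⟩
  | succ k ih =>
    have hle : L ≤ 8 ^ (k + 1) * L := le_mul_of_one_le_left (by linarith) (one_le_pow₀ (by norm_num))
    obtain ⟨s, hs, b', hb', hst', hlt⟩ := h.exists_earlier (hL₀.trans hle) (hL8.trans hle) hb hst hm
    have := ih hb' (by convert hst' using 1; ring) (hm.trans hlt.le)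
    refine lt_of_le_of_lt (Nat.succ_le_of_lt this) (Finset.card_lt_card ?_)
    rw [Finset.ssubset_iff_of_subset]
    · refine ⟨par b, by simp, ?_⟩
      simpa using lt_of_le_of_lt (selCount_mono beam (par b) hs) hlt
    · intro p hp
      simp only [Finset.mem_filter, Finset.mem_univ, true_and] at hp ⊢
      exact hlt.le.trans (hp.trans (selCount_mono beam p hs))

/-- Every child of a node visited infinitely often is visited infinitely often. -/
theorem FavorsStarved.tendsto_selCount [Fintype α] [Fintype β]
    (h : FavorsStarved par node sel beam L₀) {a : α} (ha : a ∈ node)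
    (hp : Tendsto (fun t => selCount beam t (par a)) atTop atTop) :
    Tendsto (fun t => selCount sel t a) atTop atTop := by
  classical
  refine tendsto_atTop_atTop_of_monotone' (selCount_mono sel a) ?_
  rintro ⟨C, hC⟩
  set L := max (2 * L₀) 8 with hLdef
  -- High enough to go back `Fintype.card β` times; `a` is starved at level `4 * D` so that the
  -- selected node is starved at level `D`.
  set D := 8 ^ Fintype.card β * L with hD
  have hLD : L ≤ D := le_mul_of_one_le_left (by positivity) (one_le_pow₀ (by norm_num))
  have hL₀D : L₀ ≤ 4 * D := by
    have h1 := le_max_left (2 * L₀) 8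
    have h2 := le_max_right (2 * L₀) 8
    rw [← hLdef] at h1 h2
    linarith
  have hD0 : 0 ≤ D := by positivity
  set B := (2 * Fintype.card α + 3) ^ 2 with hB
  have hstarved : ∀ᶠ t in atTop, 0 < selCount beam t (par a) ∧ Starved par sel beam (4 * D) t a := by
    have hlog := Real.tendsto_log_atTop.comp (tendsto_natCast_atTop_atTop.comp hp)
    filter_upwards [hp.eventually_gt_atTop 0, hlog.eventually_ge_atTop (4 * D * C)] with t h1 h2
    refine ⟨h1, le_trans ?_ h2⟩
    have : (selCount sel t a : ℝ) ≤ C := by exact_mod_cast hC ⟨t, rfl⟩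
    gcongr
  obtain ⟨t₀, ht₀⟩ := eventually_atTop.1 hstarved
  have hlow : ∀ t ≥ t₀, par a ∈ beam t → ∃ b ∈ sel t, selCount sel t b < B := by
    intro t ht hpa
    obtain ⟨b, hb, hbst⟩ := h.favors _ hL₀D t a ha hpa (ht₀ t ht).1 (ht₀ t ht).2
    refine ⟨b, hb, ?_⟩
    by_contra! hcon
    have := h.lt_card (le_max_left (2 * L₀) 8) (le_max_right (2 * L₀) 8) (Fintype.card β) hb
      (by convert hbst using 1; ring) (hcon.trans (h.selCount_le t b))
    exact absurd this (not_lt.2 (Finset.card_le_univ _))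
  -- Every selection of `b` raises its count, so each `b` is selected at most `B` times with a count
  -- below `B`.
  have hfin : {t | ∃ b ∈ sel t, selCount sel t b < B}.Finite := by
    have : {t | ∃ b ∈ sel t, selCount sel t b < B} = ⋃ b, {t | b ∈ sel t ∧ selCount sel t b < B} := by
      ext t
      simp
    rw [this]
    refine Set.finite_iUnion fun b => ?_
    refine Set.Finite.of_finite_image (f := fun t => selCount sel t b)
      ((Set.finite_lt_nat B).subset ?_) ?_
    · rintro _ ⟨t, ht, rfl⟩
      exact ht.2
    · intro s hs t ht hst
      exact Nat.count_injective (p := fun s => b ∈ sel s) hs.1 ht.1 hst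
  obtain ⟨t₁, ht₁⟩ := hfin.bddAbove
  have hbound : ∀ t ≥ max t₀ (t₁ + 1),
      selCount beam t (par a) = selCount beam (max t₀ (t₁ + 1)) (par a) := by
    intro t ht
    induction t, ht using Nat.le_induction with
    | base => rfl
    | succ t ht ih =>
      rw [selCount_succ, ih, if_neg, add_zero]
      intro hpa
      have := ht₁ (hlow t (le_trans (le_max_left _ _) ht) hpa)
      have := le_trans (le_max_right t₀ (t₁ + 1)) ht
      lia
  obtain ⟨t, h1, h2⟩ := ((hp.eventually_gt_atTop (selCount beam (max t₀ (t₁ + 1)) (par a))).and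
    (eventually_ge_atTop (max t₀ (t₁ + 1)))).exists
  exact absurd (hbound t h2) h1.ne'

end Counting

/-! ### Visits, evaluations and rewards along a run -/

section Search

variable {d : ℕ} {N : Fin d → ℕ} {I : Finset (Leaf N)} {c : ℝ} {τ : ℕ} {Q : Leaf N → ℝ}
  {ρ : Leaf N → ℕ → ℝ} {it : ℕ → Iteration N}

theorem take_depth_injective : Function.Injective (take d : Leaf N → Prefix N d) := by
  intro x y h
  funext k
  exact congrFun (congrFun h k) k.2

theorem mem_candidates {s : State N} {i : Iteration N} {j : ℕ} {p : Prefix N (j + 1)} :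
    p ∈ candidates I s i j ↔
      p ∈ layer I (j + 1) ∧ parent p ∈ i.beam j ∧ Expanded s j (parent p) := by
  simp [candidates]

theorem mem_evaluated {s : State N} {i : Iteration N} {x : Leaf N} :
    x ∈ evaluated s i ↔ ∃ j ≤ d, ∃ p ∈ i.beam j, Terminal s j p ∧ i.sim j p = x := by
  simp [evaluated]

theorem IsSearchIteration.take_mem_beam {s : State N} {i : Iteration N}
    (h : IsSearchIteration I c τ s i) {j k : ℕ} (hjk : j ≤ k) (hk : k ≤ d) {x : Leaf N}
    (hx : take k x ∈ i.beam k) : take j x ∈ i.beam j := by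
  induction k, hjk using Nat.le_induction with
  | base => exact hx
  | succ k _ ih =>
    have := h.subset k hk hx
    rw [mem_candidates] at this
    exact ih (by lia) this.2.1

theorem IsSearchIteration.evaluated_subset {s : State N} {i : Iteration N}
    (h : IsSearchIteration I c τ s i) : evaluated s i ⊆ I := by
  intro x hx
  obtain ⟨j, hj, p, hp, ht, rfl⟩ := mem_evaluated.1 hx
  exact (h.sim_mem j hj p hp ht).1

theorem IsSearchIteration.mem_evaluated_of_take_mem {s : State N} {i : Iteration N}
    (h : IsSearchIteration I c τ s i) {x : Leaf N} (hx : take d x ∈ i.beam d) :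
    x ∈ evaluated s i := by
  refine mem_evaluated.2 ⟨d, le_rfl, take d x, hx, Or.inl rfl, ?_⟩
  exact take_depth_injective (h.sim_mem d le_rfl _ hx (Or.inl rfl)).2

theorem visits_run (Q : Leaf N → ℝ) (ρ : Leaf N → ℕ → ℝ) (it : ℕ → Iteration N) (l j : ℕ)
    (p : Prefix N j) :
    (run Q ρ it l).visits j p = selCount (fun n => (it n).beam j) l p := by
  induction l with
  | zero => simp [run, initial, selCount]
  | succ l ih =>
    rw [selCount_succ, ← ih]
    simp only [run, step]
    congr

open Classical in
theorem evals_run_succ (Q : Leaf N → ℝ) (ρ : Leaf N → ℕ → ℝ) (it : ℕ → Iteration N) (l : ℕ)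
    (x : Leaf N) : (run Q ρ it (l + 1)).evals x =
      (run Q ρ it l).evals x + if x ∈ evaluated (run Q ρ it l) (it l) then 1 else 0 := by
  simp only [run, step]

/-- The initial tensor only adds a constant to the rewards. -/
theorem run_eq_run_zero (Q : Leaf N → ℝ) (ρ : Leaf N → ℕ → ℝ) (it : ℕ → Iteration N) (l : ℕ) :
    (run Q ρ it l).visits = (run (fun _ => 0) ρ it l).visits ∧
      (run Q ρ it l).evals = (run (fun _ => 0) ρ it l).evals ∧
      ∀ j p, (run Q ρ it l).reward j p =
        (run (fun _ => 0) ρ it l).reward j p + completionSum Q j p := by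
  induction l with
  | zero => simp [run, initial, completionSum]
  | succ l ih =>
    obtain ⟨hv, he, hr⟩ := ih
    have hev : evaluated (run Q ρ it l) (it l) = evaluated (run (fun _ => 0) ρ it l) (it l) := by
      ext x
      simp only [mem_evaluated, Terminal, Expanded, hv]
    refine ⟨?_, ?_, fun j p => ?_⟩
    · simp only [run, step, hv]
    · simp only [run, step, he, hev]
    · simp only [run, step, hr, he, hev]
      ring

theorem ucb_run_eq (c : ℝ) (Q : Leaf N → ℝ) (ρ : Leaf N → ℕ → ℝ) (it : ℕ → Iteration N) (l j : ℕ)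
    (p : Prefix N (j + 1)) :
    ucb c (run Q ρ it l) j p = ucb c (run (fun _ => 0) ρ it l) j p +
      ((completionSum Q (j + 1) p / (run Q ρ it l).visits (j + 1) p : ℝ) : EReal) := by
  obtain ⟨hv, -, hr⟩ := run_eq_run_zero Q ρ it l
  simp only [ucb, hv, hr]
  split_ifs with h
  · simp
  · rw [← EReal.coe_add]
    congr 1
    ring

/-- From some time on, an evaluated leaf is evaluated through selected nodes only. -/
theorem eventually_take_mem_beam (h : ∀ l, IsSearchIteration I c τ (run Q ρ it l) (it l)) {j : ℕ}
    (hj : j ≤ d) : ∀ᶠ n in atTop, ∀ x ∈ evaluated (run Q ρ it n) (it n),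
      take j x ∈ (it n).beam j := by
  have hvis : ∀ᶠ n in atTop, ∀ (x : Leaf N) (i : Fin d), take i x ∈ (it n).beam i →
      0 < (run Q ρ it n).visits i (take i x) := by
    rw [eventually_all]
    intro x
    rw [eventually_all]
    intro i
    by_cases hex : ∃ m, take i x ∈ (it m).beam i
    · obtain ⟨m, hm⟩ := hex
      filter_upwards [eventually_gt_atTop m] with n hn _
      rw [visits_run]
      refine lt_of_lt_of_le ?_ (selCount_mono _ _ (Nat.succ_le_of_lt hn))
      simp [selCount_succ, hm]
    · exact Eventually.of_forall fun n hn => absurd ⟨n, hn⟩ hex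
  filter_upwards [hvis] with n hn x hx
  obtain ⟨i, hi, p, hp, ht, rfl⟩ := mem_evaluated.1 hx
  have htake := ((h n).sim_mem i hi p hp ht).2
  rw [← htake] at hp
  rcases le_or_gt j i with hji | hij
  · exact (h n).take_mem_beam hji hi hp
  · have hid : i < d := hij.trans_le hj
    rcases ht with rfl | ht
    · exact absurd hid (lt_irrefl _)
    · refine absurd (Or.inr ?_) ht
      have := hn _ ⟨i, hid⟩ hp
      rwa [htake] at this

theorem evals_run_eq_zero (h : ∀ l, IsSearchIteration I c τ (run Q ρ it l) (it l)) {x : Leaf N}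
    (hx : x ∉ I) (l : ℕ) : (run Q ρ it l).evals x = 0 := by
  induction l with
  | zero => rfl
  | succ l ih =>
    rw [evals_run_succ, ih, if_neg]
    exact fun hx' => hx ((h l).evaluated_subset hx')

theorem evals_run_add_le {j l₀ : ℕ} (hl₀ : ∀ n ≥ l₀, ∀ x ∈ evaluated (run Q ρ it n) (it n),
      take j x ∈ (it n).beam j) (x : Leaf N) {l : ℕ} (hl : l₀ ≤ l) :
    (run Q ρ it l).evals x + (run Q ρ it l₀).visits j (take j x) ≤
      (run Q ρ it l).visits j (take j x) + (run Q ρ it l₀).evals x := by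
  induction l, hl using Nat.le_induction with
  | base => lia
  | succ l hl ih =>
    rw [evals_run_succ]
    have hv := visits_run Q ρ it (l + 1) j (take j x)
    rw [selCount_succ, ← visits_run Q ρ] at hv
    rw [hv]
    split_ifs with h1 h2
    · lia
    · exact absurd (hl₀ l hl x h1) h2
    · lia
    · lia

/-- At depth `d` the converse also holds: a selected leaf is terminal and is its own only
completion, so it is evaluated. -/
theorem evals_run_add_eq (h : ∀ l, IsSearchIteration I c τ (run Q ρ it l) (it l)) {l₀ : ℕ}
    (hl₀ : ∀ n ≥ l₀, ∀ x ∈ evaluated (run Q ρ it n) (it n), take d x ∈ (it n).beam d) (x : Leaf N)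
    {l : ℕ} (hl : l₀ ≤ l) :
    (run Q ρ it l).evals x + (run Q ρ it l₀).visits d (take d x) =
      (run Q ρ it l).visits d (take d x) + (run Q ρ it l₀).evals x := by
  refine le_antisymm (evals_run_add_le hl₀ x hl) ?_
  induction l, hl using Nat.le_induction with
  | base => lia
  | succ l hl ih =>
    rw [evals_run_succ]
    have hv := visits_run Q ρ it (l + 1) d (take d x)
    rw [selCount_succ, ← visits_run Q ρ] at hv
    rw [hv]
    split_ifs with h1 h2
    · lia
    · exact absurd ((h l).mem_evaluated_of_take_mem h1) h2
    · lia
    · lia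

open Classical in
theorem reward_run_eq {j l₀ : ℕ} (hl₀ : ∀ n ≥ l₀, ∀ x ∈ evaluated (run Q ρ it n) (it n),
      take j x ∈ (it n).beam j) (p : Prefix N j) {l : ℕ} (hl : l₀ ≤ l) :
    (run Q ρ it l).reward j p = (run Q ρ it l₀).reward j p +
      ∑ x with take j x = p, (∑ k ∈ Finset.range ((run Q ρ it l).evals x), ρ x k -
        ∑ k ∈ Finset.range ((run Q ρ it l₀).evals x), ρ x k) := by
  induction l, hl using Nat.le_induction with
  | base => simp
  | succ l hl ih =>
    have hstep : (run Q ρ it (l + 1)).reward j p = (run Q ρ it l).reward j p +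
        ∑ x with take j x = p, if x ∈ evaluated (run Q ρ it l) (it l) then
          ρ x ((run Q ρ it l).evals x) else 0 := by
      rw [← Finset.sum_filter, Finset.filter_filter]
      simp only [run, step]
      congr 1
      split_ifs with hp
      · refine Finset.sum_congr ?_ fun _ _ => rfl
        ext x
        simp [and_comm]
      · symm
        apply Finset.sum_eq_zero
        intro x hx
        obtain ⟨-, rfl, hxe⟩ := Finset.mem_filter.1 hx
        exact absurd (hl₀ l hl x hxe) hp
    rw [hstep, ih, add_assoc, ← Finset.sum_add_distrib]
    congr 1
    refine Finset.sum_congr rfl fun x _ => ?_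
    rw [evals_run_succ]
    split_ifs
    · rw [Finset.sum_range_succ]
      ring
    · simp

theorem exists_abs_sum_range_le {f : ℕ → ℝ} {a : ℝ}
    (hf : Tendsto (fun n : ℕ => (∑ k ∈ Finset.range n, f k) / n) atTop (𝓝 a)) :
    ∃ A, 0 ≤ A ∧ ∀ n : ℕ, |∑ k ∈ Finset.range n, f k| ≤ A * n := by
  obtain ⟨A, hA⟩ := hf.abs.bddAbove_range
  have hA' : ∀ n : ℕ, |(∑ k ∈ Finset.range n, f k) / n| ≤ A := fun n => hA ⟨n, rfl⟩
  refine ⟨A, (abs_nonneg _).trans (hA' 0), fun n => ?_⟩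
  rcases Nat.eq_zero_or_pos n with rfl | hn
  · simp
  · have hn' : (0 : ℝ) < n := by exact_mod_cast hn
    have := hA' n
    rwa [abs_div, abs_of_pos hn', div_le_iff₀ hn'] at this

theorem exists_abs_reward_le (h : ∀ l, IsSearchIteration I c τ (run Q ρ it l) (it l))
    {T : Leaf N → ℝ} (hT : ∀ x ∈ I,
      Tendsto (fun n : ℕ => (∑ k ∈ Finset.range n, ρ x k) / n) atTop (𝓝 (T x)))
    {j : ℕ} (hj : j ≤ d) (p : Prefix N j) :
    ∃ C A : ℝ, 0 ≤ C ∧ 0 ≤ A ∧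
      ∀ l, |(run Q ρ it l).reward j p| ≤ C + A * (run Q ρ it l).visits j p := by
  classical
  obtain ⟨l₀, hl₀⟩ := eventually_atTop.1 (eventually_take_mem_beam h hj)
  have hsum : ∀ x, ∃ A : ℝ, 0 ≤ A ∧ ∀ l,
      |∑ k ∈ Finset.range ((run Q ρ it l).evals x), ρ x k| ≤ A * (run Q ρ it l).evals x := by
    intro x
    by_cases hx : x ∈ I
    · obtain ⟨A, hA, hA'⟩ := exists_abs_sum_range_le (hT x hx)
      exact ⟨A, hA, fun l => hA' _⟩
    · exact ⟨0, le_rfl, fun l => by simp [evals_run_eq_zero h hx]⟩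
  choose A hA hA' using hsum
  set C₀ := ∑ l ∈ Finset.range l₀, |(run Q ρ it l).reward j p| with hC₀
  -- One copy bounds the subtracted partial sum, the other the excess of evaluations over visits.
  set C₁ := ∑ x with take j x = p, 2 * A x * (run Q ρ it l₀).evals x with hC₁
  have hC₀0 : 0 ≤ C₀ := Finset.sum_nonneg fun _ _ => abs_nonneg _
  have hC₁0 : 0 ≤ C₁ := Finset.sum_nonneg fun x _ => by
    have := hA x
    positivity
  have hA0 : 0 ≤ ∑ x with take j x = p, A x := Finset.sum_nonneg fun x _ => hA x
  refine ⟨C₀ + |(run Q ρ it l₀).reward j p| + C₁, ∑ x with take j x = p, A x, by positivity, hA0,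
    fun l => ?_⟩
  have hv0 : (0 : ℝ) ≤ (run Q ρ it l).visits j p := by positivity
  rcases lt_or_ge l l₀ with hl | hl
  · have : |(run Q ρ it l).reward j p| ≤ C₀ :=
      Finset.single_le_sum (f := fun l => |(run Q ρ it l).reward j p|) (fun _ _ => abs_nonneg _)
        (Finset.mem_range.2 hl)
    have h2 := abs_nonneg ((run Q ρ it l₀).reward j p)
    have h3 := mul_nonneg hA0 hv0
    linarith
  · rw [reward_run_eq hl₀ p hl]
    have hle : |∑ x with take j x = p, (∑ k ∈ Finset.range ((run Q ρ it l).evals x), ρ x k -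
        ∑ k ∈ Finset.range ((run Q ρ it l₀).evals x), ρ x k)| ≤
        C₁ + (∑ x with take j x = p, A x) * (run Q ρ it l).visits j p := by
      refine (Finset.abs_sum_le_sum_abs _ _).trans ?_
      rw [Finset.sum_mul, hC₁, ← Finset.sum_add_distrib]
      refine Finset.sum_le_sum fun x hx => ?_
      obtain ⟨-, rfl⟩ := Finset.mem_filter.1 hx
      have h1 := hA' x l
      have h2 := hA' x l₀
      have h3 : ((run Q ρ it l).evals x : ℝ) ≤ (run Q ρ it l).visits j (take j x) +
          (run Q ρ it l₀).evals x := by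
        have := evals_run_add_le hl₀ x hl
        exact_mod_cast (by lia : (run Q ρ it l).evals x ≤
          (run Q ρ it l).visits j (take j x) + (run Q ρ it l₀).evals x)
      have h4 := mul_le_mul_of_nonneg_left h3 (hA x)
      have h5 := abs_sub (∑ k ∈ Finset.range ((run Q ρ it l).evals x), ρ x k)
        (∑ k ∈ Finset.range ((run Q ρ it l₀).evals x), ρ x k)
      linarith
    have := abs_add_le ((run Q ρ it l₀).reward j p)
      (∑ x with take j x = p, (∑ k ∈ Finset.range ((run Q ρ it l).evals x), ρ x k -
        ∑ k ∈ Finset.range ((run Q ρ it l₀).evals x), ρ x k))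
    linarith

/-- The exploitation terms are bounded. -/
theorem exists_abs_reward_div_visits_le (h : ∀ l, IsSearchIteration I c τ (run Q ρ it l) (it l))
    {T : Leaf N → ℝ} (hT : ∀ x ∈ I,
      Tendsto (fun n : ℕ => (∑ k ∈ Finset.range n, ρ x k) / n) atTop (𝓝 (T x)))
    {j : ℕ} (hj : j ≤ d) :
    ∃ W : ℝ, ∀ l p, 0 < (run Q ρ it l).visits j p →
      |(run Q ρ it l).reward j p / (run Q ρ it l).visits j p| ≤ W := by
  choose C A hC hA hCA using exists_abs_reward_le (ρ := ρ) h hT hj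
  have hsum : ∀ p, C p + A p ≤ ∑ p, (C p + A p) := fun p =>
    Finset.single_le_sum (f := fun p => C p + A p) (fun p _ => add_nonneg (hC p) (hA p))
      (Finset.mem_univ p)
  refine ⟨∑ p, (C p + A p), fun l p hp => le_trans ?_ (hsum p)⟩
  have hp' : (1 : ℝ) ≤ (run Q ρ it l).visits j p := by exact_mod_cast hp
  rw [abs_div, abs_of_pos (by linarith : (0 : ℝ) < (run Q ρ it l).visits j p),
    div_le_iff₀ (by linarith)]
  have := hCA p l
  have := le_mul_of_one_le_right (hC p) hp'
  linarith

/-- If `b` beats `a`, its exploration term is at least `c * √L - 2 * W`. The threshold `(4 * W / c)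
^ 2` makes this at least `c * √L / 2`, which is starvation at level `L / 4`. -/
theorem favorsStarved (hc : 0 < c) (hτ : 1 ≤ τ)
    (h : ∀ l, IsSearchIteration I c τ (run Q ρ it l) (it l)) {j : ℕ} (hj : j < d) {W : ℝ}
    (hbound : ∀ l p, 0 < (run Q ρ it l).visits (j + 1) p →
      |(run Q ρ it l).reward (j + 1) p / (run Q ρ it l).visits (j + 1) p| ≤ W) :
    FavorsStarved (parent (N := N)) (layer I (j + 1) : Set (Prefix N (j + 1)))
      (fun n => (it n).beam (j + 1)) (fun n => (it n).beam j) ((4 * W / c) ^ 2) where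
  mem_node t a ha := by
    have := (h t).subset j hj ha
    rw [mem_candidates] at this
    exact this.1
  par_mem t a ha := by
    have := (h t).subset j hj ha
    rw [mem_candidates] at this
    exact this.2.1
  favors L hL t a ha hpa hpos hst := by
    have hL0 : 0 ≤ L := (sq_nonneg _).trans hL
    have hcand : a ∈ candidates I (run Q ρ it t) (it t) j := by
      refine mem_candidates.2 ⟨ha, hpa, Or.inr ?_⟩
      rwa [visits_run]
    unfold Starved at hst ⊢
    simp only [← visits_run Q ρ it] at hst ⊢
    by_cases hsel : a ∈ (it t).beam (j + 1)
    · refine ⟨a, hsel, le_trans ?_ hst⟩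
      gcongr
      linarith
    have hne : ((it t).beam (j + 1)).Nonempty := by
      have := Finset.card_pos.2 ⟨a, hcand⟩
      rw [← Finset.card_pos, (h t).card j hj]
      lia
    obtain ⟨b, hb⟩ := hne
    refine ⟨b, hb, ?_⟩
    have hle := (h t).best j hj a hcand hsel b hb
    set s := run Q ρ it t
    -- An unvisited node is starved at every level.
    rcases Nat.eq_zero_or_pos (s.visits (j + 1) b) with hb0 | hb0
    · rw [hb0]
      simpa using Real.log_natCast_nonneg _
    rcases Nat.eq_zero_or_pos (s.visits (j + 1) a) with ha0 | ha0
    · simp [ucb, ha0, hb0.ne'] at hle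
      exact absurd hle (EReal.coe_ne_top _)
    rw [ucb, ucb, if_neg ha0.ne', if_neg hb0.ne', EReal.coe_le_coe_iff] at hle
    have hWa := (abs_le.1 (hbound t a ha0)).1
    have hWb := (abs_le.1 (hbound t b hb0)).2
    have ha' : (0 : ℝ) < s.visits (j + 1) a := by exact_mod_cast ha0
    have hb' : (0 : ℝ) < s.visits (j + 1) b := by exact_mod_cast hb0
    have hLa : √L ≤ √(Real.log (s.visits j (parent a)) / s.visits (j + 1) a) :=
      Real.sqrt_le_sqrt ((le_div_iff₀ ha').2 hst)
    have hLW : 4 * W ≤ c * √L := by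
      have := Real.le_sqrt_of_sq_le hL
      rwa [div_le_iff₀' hc] at this
    have hca := mul_le_mul_of_nonneg_left hLa hc.le
    have hsqrt : √(L / 4) ≤ √(Real.log (s.visits j (parent b)) / s.visits (j + 1) b) := by
      rw [Real.sqrt_div hL0, show (4 : ℝ) = 2 ^ 2 by norm_num, Real.sqrt_sq (by norm_num)]
      refine le_of_mul_le_mul_left ?_ hc
      linarith
    rw [Real.sqrt_le_sqrt_iff (div_nonneg (Real.log_natCast_nonneg _) hb'.le),
      le_div_iff₀ hb'] at hsqrt
    exact hsqrt

theorem tendsto_visits (hc : 0 < c) (hτ : 1 ≤ τ)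
    (h : ∀ l, IsSearchIteration I c τ (run Q ρ it l) (it l))
    {T : Leaf N → ℝ} (hT : ∀ x ∈ I,
      Tendsto (fun n : ℕ => (∑ k ∈ Finset.range n, ρ x k) / n) atTop (𝓝 (T x)))
    {j : ℕ} (hj : j ≤ d) {p : Prefix N j} (hp : p ∈ layer I j) :
    Tendsto (fun l => (run Q ρ it l).visits j p) atTop atTop := by
  simp only [visits_run]
  induction j with
  | zero =>
    have : ∀ l, selCount (fun n => (it n).beam 0) l p = l := by
      intro l
      induction l with
      | zero => simp [selCount]
      | succ l ih => rw [selCount_succ, ih, if_pos (by simp [(h l).root])]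
    simp only [this]
    exact tendsto_id
  | succ j ih =>
    obtain ⟨W, hbound⟩ := exists_abs_reward_div_visits_le h hT hj
    refine (favorsStarved hc hτ h hj hbound).tendsto_selCount hp (ih (by lia) ?_)
    obtain ⟨x, hx, rfl⟩ := Finset.mem_image.1 hp
    exact Finset.mem_image.2 ⟨x, hx, rfl⟩

theorem tendsto_estimate (hc : 0 < c) (hτ : 1 ≤ τ)
    (h : ∀ l, IsSearchIteration I c τ (run Q ρ it l) (it l))
    {T : Leaf N → ℝ} (hT : ∀ x ∈ I,
      Tendsto (fun n : ℕ => (∑ k ∈ Finset.range n, ρ x k) / n) atTop (𝓝 (T x)))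
    {x : Leaf N} (hx : x ∈ I) :
    Tendsto (fun l => estimate (run Q ρ it l) x) atTop (𝓝 (T x)) := by
  classical
  obtain ⟨l₀, hl₀⟩ := eventually_atTop.1 (eventually_take_mem_beam h le_rfl)
  have hv : Tendsto (fun l => (run Q ρ it l).visits d (take d x)) atTop atTop :=
    tendsto_visits hc hτ h hT le_rfl (Finset.mem_image_of_mem _ hx)
  have hvR : Tendsto (fun l => ((run Q ρ it l).visits d (take d x) : ℝ)) atTop atTop :=
    tendsto_natCast_atTop_atTop.comp hv
  have hn : Tendsto (fun l => (run Q ρ it l).evals x) atTop atTop := by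
    refine tendsto_atTop.2 fun b => ?_
    filter_upwards [eventually_ge_atTop l₀,
      hv.eventually_ge_atTop (b + (run Q ρ it l₀).visits d (take d x))] with l h1 h2
    have := evals_run_add_eq h hl₀ x h1
    lia
  set K := (run Q ρ it l₀).reward d (take d x) -
    ∑ k ∈ Finset.range ((run Q ρ it l₀).evals x), ρ x k with hK
  set D : ℝ := (run Q ρ it l₀).evals x - (run Q ρ it l₀).visits d (take d x) with hD
  -- The reward is `K` plus the sum of the first `evals` rewards, and `evals = visits + D`; both
  -- constants vanish after division by the visit count.
  have hlim : Tendsto (fun l => K / (run Q ρ it l).visits d (take d x) +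
      (∑ k ∈ Finset.range ((run Q ρ it l).evals x), ρ x k) / (run Q ρ it l).evals x *
        (1 + D / (run Q ρ it l).visits d (take d x))) atTop (𝓝 (0 + T x * (1 + 0))) :=
    (hvR.const_div_atTop K).add (((hT x hx).comp hn).mul ((hvR.const_div_atTop D).const_add 1))
  rw [add_zero, mul_one, zero_add] at hlim
  refine hlim.congr' ?_
  filter_upwards [eventually_ge_atTop l₀, hv.eventually_gt_atTop 0, hn.eventually_gt_atTop 0] with
    l h1 h2 h3
  rw [estimate, if_neg h2.ne', reward_run_eq hl₀ _ h1]
  have hfilter : (Finset.univ.filter fun y : Leaf N => take d y = take d x) = {x} := by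
    ext y
    simp [take_depth_injective.eq_iff]
  rw [hfilter, Finset.sum_singleton]
  have h4 : ((run Q ρ it l).evals x : ℝ) = (run Q ρ it l).visits d (take d x) + D := by
    have : ((run Q ρ it l).evals x : ℝ) + (run Q ρ it l₀).visits d (take d x) =
        (run Q ρ it l).visits d (take d x) + (run Q ρ it l₀).evals x := by
      exact_mod_cast evals_run_add_eq h hl₀ x h1
    rw [hD]
    linarith
  have h2' : ((run Q ρ it l).visits d (take d x) : ℝ) ≠ 0 := by exact_mod_cast h2.ne'
  have h3' : ((run Q ρ it l).evals x : ℝ) ≠ 0 := by exact_mod_cast h3.ne'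
  have h5 : 1 + D / (run Q ρ it l).visits d (take d x) =
      (run Q ρ it l).evals x / (run Q ρ it l).visits d (take d x) := by
    rw [h4]
    field_simp
  rw [h5, hK]
  field_simp
  ring

end Search

/-! ### From pointwise convergence to uniform convergence and maximizers -/

section Limits

variable {X : Type*} {I : Finset X} {T : X → ℝ} {f : ℕ → X → ℝ}

theorem tendsto_sup'_abs_sub (hI : I.Nonempty)
    (h : ∀ x ∈ I, Tendsto (fun l => f l x) atTop (𝓝 (T x))) :
    Tendsto (fun l => I.sup' hI fun x => |f l x - T x|) atTop (𝓝 0) := by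
  rw [Metric.tendsto_atTop']
  intro ε hε
  have : ∀ᶠ l in atTop, ∀ x ∈ I, |f l x - T x| < ε :=
    (Finset.eventually_all I).2 fun x hx => Metric.tendsto_nhds.1 (h x hx) ε hε
  obtain ⟨l₀, hl₀⟩ := eventually_atTop.1 this
  refine ⟨l₀, fun l hl => ?_⟩
  rw [Real.dist_0_eq_abs, abs_lt]
  obtain ⟨x, hx⟩ := hI
  refine ⟨?_, (Finset.sup'_lt_iff _).2 (hl₀ l hl.le)⟩
  exact (neg_lt_zero.2 hε).trans_le
    ((abs_nonneg _).trans (Finset.le_sup' (fun x => |f l x - T x|) hx))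

theorem eventually_isMaxOn_of_tendsto
    (h : ∀ x ∈ I, Tendsto (fun l => f l x) atTop (𝓝 (T x))) :
    ∀ᶠ l in atTop, ∀ x ∈ I, IsMaxOn (f l) (I : Set X) x → IsMaxOn T (I : Set X) x := by
  have : ∀ᶠ l in atTop, ∀ x ∈ I, ∀ y ∈ I, T x < T y → f l x < f l y := by
    -- Only finitely many strict inequalities between values of `T` have to be inherited by `f l`.
    refine (Finset.eventually_all I).2 fun x hx => (Finset.eventually_all I).2 fun y hy => ?_
    by_cases hxy : T x < T y
    · filter_upwards [(h x hx).eventually_lt (h y hy) hxy] with l hl _ using hl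
    · exact Eventually.of_forall fun l hl => absurd hl hxy
  filter_upwards [this] with l hl x hx hmax y hy
  by_contra hcon
  exact absurd (hmax hy) (not_le.2 (hl x hx y hy (not_le.1 hcon)))

end Limits

end TTTS

theorem theorem3 {d : ℕ} {N : Fin d → ℕ}
    -- the tree, its true leaf values, the tensor-train value model, and the search parameters
    (I : Finset (TTTS.Leaf N)) (hI : I.Nonempty) (T : TTTS.Leaf N → ℝ) (M : TTTS.TTModel N)
    (c : ℝ) (hc : 0 < c) (τ : ℕ) (hτ : 1 ≤ τ)
    -- `R x k` is the outcome of the evaluation number `k` of the leaf `x`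
    {Ω : Type*} [MeasurableSpace Ω] (μ : Measure Ω) [IsProbabilityMeasure μ]
    (R : TTTS.Leaf N → ℕ → Ω → ℝ)
    (hint : ∀ x ∈ I, Integrable (R x 0) μ)
    (hindep : ∀ x ∈ I, Pairwise fun k m => IndepFun (R x k) (R x m) μ)
    (hident : ∀ x ∈ I, ∀ k, IdentDistrib (R x k) (R x 0) μ μ)
    (hmean : ∀ x ∈ I, ∫ ω, R x 0 ω ∂μ = T x)
    -- a random run of the search, initialized with the tensor-train model
    (it : ℕ → Ω → TTTS.Iteration N) (S : ℕ → Ω → TTTS.State N)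
    (hS : ∀ l ω, S l ω = TTTS.run M.eval (fun x k => R x k ω) (fun n => it n ω) l)
    (hit : ∀ᵐ ω ∂μ, ∀ l, TTTS.IsSearchIteration I c τ (S l ω) (it l ω)) :
    -- almost surely: every node is visited infinitely often, the value estimates converge uniformly
    -- to the true values, and eventually every maximizer of the estimates is a global maximizer
    (∀ᵐ ω ∂μ,
      (∀ j ≤ d, ∀ p ∈ TTTS.layer I j, Tendsto (fun l => (S l ω).visits j p) atTop atTop) ∧
      Tendsto (fun l => I.sup' hI fun x => |TTTS.estimate (S l ω) x - T x|) atTop (𝓝 0) ∧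
      ∀ᶠ l in atTop, ∀ x ∈ I,
        IsMaxOn (TTTS.estimate (S l ω)) (I : Set (TTTS.Leaf N)) x →
          IsMaxOn T (I : Set (TTTS.Leaf N)) x) ∧
    -- for the same history, initialization with the model and with zero give the same visit counts,
    -- and the upper confidence bounds differ only in the exploitation term, by the initial value
    -- over the visit count
    ∀ (ρ : TTTS.Leaf N → ℕ → ℝ) (h : ℕ → TTTS.Iteration N) (l j : ℕ),
      (TTTS.run M.eval ρ h l).visits = (TTTS.run (fun _ => 0) ρ h l).visits ∧
      ∀ p : TTTS.Prefix N (j + 1),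
        TTTS.ucb c (TTTS.run M.eval ρ h l) j p =
          TTTS.ucb c (TTTS.run (fun _ => 0) ρ h l) j p +
            ((TTTS.completionSum M.eval (j + 1) p /
              (TTTS.run M.eval ρ h l).visits (j + 1) p : ℝ) : EReal) := by
  refine ⟨?_, fun ρ h l j => ⟨(TTTS.run_eq_run_zero M.eval ρ h l).1, TTTS.ucb_run_eq c M.eval ρ h l j⟩⟩
  have hlln : ∀ᵐ ω ∂μ, ∀ x ∈ I,
      Tendsto (fun n : ℕ => (∑ k ∈ Finset.range n, R x k ω) / n) atTop (𝓝 (T x)) := by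
    rw [ae_all_iff]
    intro x
    by_cases hx : x ∈ I
    · filter_upwards [strong_law_ae_real (R x) (hint x hx) (hindep x hx) (hident x hx)] with ω hω _
      rwa [hmean x hx] at hω
    · exact Eventually.of_forall fun ω h => absurd h hx
  filter_upwards [hlln, hit] with ω hT hω
  simp only [hS] at hω ⊢
  have hlim := fun x hx => TTTS.tendsto_estimate (x := x) hc hτ hω hT hx
  exact ⟨fun j hj p hp => TTTS.tendsto_visits hc hτ hω hT hj hp,
    TTTS.tendsto_sup'_abs_sub hI hlim, TTTS.eventually_isMaxOn_of_tendsto hlim⟩
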